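/- Work in $\mathbb{R}^2$ with the Euclidean norm. An instance of nested convex body chasing is a starting point $v_0$ together with convex bodies $F_1\supseteq F_2\supseteq\cdots$; it is $r$-bounded if every $F_t$ lies in the closed ball of radius $r$ about $v_0$. A trajectory $v_0,v_1,v_2,\dots$ with $v_t\in F_t$ has cost $\sum_{t=1}^N\|v_t-v_{t-1}\|$ on the first $N$ requests, and $\mathrm{OPT}_N$ is the infimum of this cost over all such trajectories. The *ellipsoid algorithm* (resp. *centroid algorithm*) stays put while its position lies in the current $F_t$, and otherwise moves to the centre of the minimum-volume ellipsoid enclosing $F_t$ (resp. to the centroid of $F_t$). For $0<\alpha<1$ and $i\ge 0$ put $$R_i=\{(x,y): 2y\le(\alpha^{2i}-\alpha^{2i+1})x+\alpha^{2i}+\alpha^{2i+1}\},$$ $$L_i=\{(x,y): 2y\le(\alpha^{2i+2}-\alpha^{2i+1})x+\alpha^{2i+2}+\alpha^{2i+1}\},$$ and, for a halfspace $H$, let $K(H)=\{(x,y)\in H: y\ge 0,\ -1\le x\le 1\}$. The *adversarial construction* with parameter $\alpha$ starts the algorithm at $v_0=(0,1)$ and requests $F_1=K(H_1)$ with $H_1=\{2y\le(1-\alpha)x+1+\alpha\}=R_0$;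 for even $t\ge2$ it requests $F_t=K(L_i)$, where $i$ is the smallest index such that $L_i$ does not contain the current position $v_{t-1}$ of the algorithm; for odd $t\ge 3$ it requests $F_t=K(R_i)$ with $i$ the smallest index such that $v_{t-1}\notin R_i$. (A) There is $0<\alpha<1$ such that $F_1$ has a unique minimum-volume enclosing ellipsoid, and its centre is $(c,b)$ with $c>0$ and $b>0$. (B) Let $0<\alpha<1$ and let $(c,b)$, with $c,b>0$, be the centre of the minimum-volume enclosing ellipsoid of $F_1$. Then the ellipsoid algorithm can be played against the construction for infinitely many steps, and in the play: the $F_t$ are nested convex bodies contained in the closed ball of radius $\sqrt2$ about $(0,1)$; for every $t\ge1$, $v_t\in F_t$ and $v_t$ is the unique centre of a minimum-volume ellipsoid enclosing $F_t$; for odd $t$ one has $F_t=K(R_i)$ and $v_t=(c,b\alpha^{2i})$ for some $i\ge0$, and for even $t\ge2$ one has $F_t=K(L_i)$ and $v_t=(-c,b\alpha^{2i+1})$ for some $i\ge0$; and for every $N$ the algorithm travels at least $2cN$ on the first $N$ requests, while $\mathrm{OPT}_N\le1$. (C) For $\alpha=1/2$ the centroid of $F_1$ is $(1/9,7/18)$.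 For every $0<\alpha<1$ the centroid $(c,b)$ of $F_1$ has $c,b>0$, and the centroid algorithm can be played against the construction for infinitely many steps; in the play the $F_t$ are nested convex bodies contained in the closed ball of radius $\sqrt2$ about $(0,1)$; $v_t\in F_t$ for every $t\ge1$; if $t$ is odd then $F_t=K(R_i)$ and $v_t=(c,b\alpha^{2i})$ for some $i\ge0$, and if $t\ge2$ is even then $F_t=K(L_i)$ and $v_t=(-c,b\alpha^{2i+1})$ for some $i\ge0$; and for every $N$ the algorithm travels at least $2cN$ on the first $N$ requests, while $\mathrm{OPT}_N\le1$. (D) Consequently there is a single $1$-bounded nested instance in $\mathbb{R}^2$ that defeats both algorithms: for some $0<\alpha<1$ and some $\rho>0$, the instance with starting point $\rho\cdot(0,1)$ and requests $F_{2i+1}=\rho K(R_i)$, $F_{2i+2}=\rho K(L_i)$ $(i\ge0)$ is nested and $1$-bounded, has $\mathrm{OPT}_N\le 1$ for every $N$, and on it both the ellipsoid algorithm and the centroid algorithm always stay feasible and travel a total distance that tends to infinity with the number of requests. -/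

import Mathlib

open Set Filter Topology MeasureTheory
open scoped ENNReal Pointwise

noncomputable section

namespace NestedChasing

/-! ### Ellipsoids and centroids -/

/-- `E` is a (non-degenerate) ellipsoid with centre `z`: the image of the closed unit ball under an
invertible affine map sending the origin to `z`. -/
def IsEllipsoidAt {d : ℕ} (E : Set (EuclideanSpace ℝ (Fin d))) (z : EuclideanSpace ℝ (Fin d)) :
    Prop :=
  ∃ A : EuclideanSpace ℝ (Fin d) ≃L[ℝ] EuclideanSpace ℝ (Fin d),
    E = (fun u => z + A u) '' Metric.closedBall 0 1

/-- `E` is an ellipsoid with centre `z` that contains `S` and has the smallest volume among all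
ellipsoids containing `S`. -/
def IsMinEllipsoidAt {d : ℕ} (S E : Set (EuclideanSpace ℝ (Fin d)))
    (z : EuclideanSpace ℝ (Fin d)) : Prop :=
  IsEllipsoidAt E z ∧ S ⊆ E ∧
    ∀ E' z', IsEllipsoidAt E' z' → S ⊆ E' → volume E ≤ volume E'

/-- `z` is the centre of a minimum-volume ellipsoid enclosing `S`. -/
def IsMinEllipsoidCenter {d : ℕ} (S : Set (EuclideanSpace ℝ (Fin d)))
    (z : EuclideanSpace ℝ (Fin d)) : Prop :=
  ∃ E, IsMinEllipsoidAt S E z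

/-- `z` is the centroid (centre of mass for the uniform distribution) of `S`. -/
def IsCentroid {d : ℕ} (S : Set (EuclideanSpace ℝ (Fin d)))
    (z : EuclideanSpace ℝ (Fin d)) : Prop :=
  z = ⨍ x in S, x ∂volume

/-! ### Nested convex body chasing

An instance consists of a starting point `v₀` and requests `F 1, F 2, F 3, …` (the value `F 0` is
never used); its first `N` requests form a finite instance.  A trajectory is a sequence
`v 0 = v₀, v 1, v 2, …`, where `v t` is the position after serving the request `F t`. -/

/-- The requests are convex bodies (convex, compact, with non-empty interior) and are nested. -/
structure IsNested {d : ℕ} (F : ℕ → Set (EuclideanSpace ℝ (Fin d))) : Prop where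
  convex : ∀ t, 1 ≤ t → Convex ℝ (F t)
  compact : ∀ t, 1 ≤ t → IsCompact (F t)
  interior_nonempty : ∀ t, 1 ≤ t → (interior (F t)).Nonempty
  nested : ∀ t, 1 ≤ t → F (t + 1) ⊆ F t

/-- Every request lies in the ball of radius `r` around the starting point. -/
def IsBoundedInstance {d : ℕ} (r : ℝ) (v₀ : EuclideanSpace ℝ (Fin d))
    (F : ℕ → Set (EuclideanSpace ℝ (Fin d))) : Prop :=
  ∀ t, 1 ≤ t → F t ⊆ Metric.closedBall v₀ r

/-- The distance travelled along `v` while serving the first `N` requests. -/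
def cost {d : ℕ} (v : ℕ → EuclideanSpace ℝ (Fin d)) (N : ℕ) : ℝ :=
  ∑ t ∈ Finset.range N, dist (v t) (v (t + 1))

/-- The optimal offline cost of serving the first `N` requests. -/
def opt {d : ℕ} (v₀ : EuclideanSpace ℝ (Fin d)) (F : ℕ → Set (EuclideanSpace ℝ (Fin d)))
    (N : ℕ) : ℝ≥0∞ :=
  ⨅ (u : ℕ → EuclideanSpace ℝ (Fin d)) (_ : u 0 = v₀ ∧ ∀ t, 1 ≤ t → t ≤ N → u t ∈ F t),
    ∑ t ∈ Finset.range N, edist (u t) (u (t + 1))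

/-- `v` is a run, on the instance `(v₀, F)`, of the algorithm that stays where it is as long as its
position is feasible, and otherwise moves to a point selected by `rule` from the current request. -/
def IsRun {d : ℕ}
    (rule : Set (EuclideanSpace ℝ (Fin d)) → EuclideanSpace ℝ (Fin d) → Prop)
    (v₀ : EuclideanSpace ℝ (Fin d)) (F : ℕ → Set (EuclideanSpace ℝ (Fin d)))
    (v : ℕ → EuclideanSpace ℝ (Fin d)) : Prop :=
  v 0 = v₀ ∧ ∀ t, (v t ∈ F (t + 1) → v (t + 1) = v t) ∧
    (v t ∉ F (t + 1) → rule (F (t + 1)) (v (t + 1)))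

/-! ### The lower-bound construction in the plane -/

/-- The Euclidean plane. -/
abbrev Plane := EuclideanSpace ℝ (Fin 2)

/-- The point with coordinates `(x, y)`. -/
def pt (x y : ℝ) : Plane := !₂[x, y]

/-- The intersection of `H` with the three halfspaces `y ≥ 0`, `x ≥ -1` and `x ≤ 1`. -/
def body (H : Set Plane) : Set Plane :=
  {p | 0 ≤ p 1} ∩ {p | -1 ≤ p 0} ∩ {p | p 0 ≤ 1} ∩ H

/-- The halfspace `H₁`. -/
def halfH (α : ℝ) : Set Plane :=
  {p | 2 * p 1 ≤ (1 - α) * p 0 + (1 + α)}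

/-- The first request `F₁`. -/
def firstBody (α : ℝ) : Set Plane := body (halfH α)

/-- The halfspace `R_i`. -/
def halfR (α : ℝ) (i : ℕ) : Set Plane :=
  {p | 2 * p 1 ≤ (α ^ (2 * i) - α ^ (2 * i + 1)) * p 0 + (α ^ (2 * i) + α ^ (2 * i + 1))}

/-- The halfspace `L_i`. -/
def halfL (α : ℝ) (i : ℕ) : Set Plane :=
  {p | 2 * p 1 ≤ (α ^ (2 * i + 2) - α ^ (2 * i + 1)) * p 0 + (α ^ (2 * i + 2) + α ^ (2 * i + 1))}

/-- `v` and `F` are the trajectory and the requests arising when the algorithm with the given `rule`,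
started at `(0, 1)`, plays against the following adversary.  The first request is `F₁`; afterwards
the `t`-th request is cut out by `L_i` (for even `t`) or by `R_i` (for odd `t`), where `i` is the
smallest index for which this halfspace does not contain the current position. -/
structure IsPlay (rule : Set Plane → Plane → Prop) (α : ℝ) (v : ℕ → Plane) (F : ℕ → Set Plane) :
    Prop where
  run : IsRun rule (pt 0 1) F v
  first : F 1 = firstBody α
  even : ∀ t, 2 ≤ t → Even t →
    ∃ i, IsLeast {j | v (t - 1) ∉ halfL α j} i ∧ F t = body (halfL α i)
  odd : ∀ t, 2 ≤ t → Odd t →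
    ∃ i, IsLeast {j | v (t - 1) ∉ halfR α j} i ∧ F t = body (halfR α i)

end NestedChasing

end

open NestedChasing

/-!
The minimum-volume ellipse of the trapezoid `F₁` can be written down. A shear turns `F₁` into an
isosceles trapezoid without changing the question, and there the ellipse through the four vertices
depends on a single parameter `c`, the abscissa of its centre. Choosing `c` as the root in `(0, 1/3)`
of `(1 - α²)(1 - c)(1 + 3c) = 4c` makes the ellipse satisfy John's criterion: after normalising it to
the unit disc, the vertices are `(x₁, ±y₁)`, `(-x₂, ±y₂)` with `x₁ x₂ = 1/2`, so suitable weights make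
them centred and isotropic. Averaging the constraint of a competing ellipse `‖B u - w‖ ≤ 1` over
these contact points and applying the inequality of arithmetic and geometric means to `BᵀB` shows
that no enclosing ellipse is smaller, and the equality case gives uniqueness
(`isMinEllipsoidAt_iff_unitDisc`, `exists_minEllipse_firstBody`). No compactness argument is needed.

Every request is the image of `F₁` under the diagonal map `(x, y) ↦ ((-1)ᵏ x, αᵏ y)`, where `k = 2i`
gives `K(R_i)` and `k = 2i + 1` gives `K(L_i)`. Centres of minimum-volume ellipses and centroids
commute with linear maps, so both algorithms, when they move, go to `((-1)ᵏ c, b αᵏ)`. The adversary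
alternates the parity of `k` and cuts off the current position, which forces a jump across the
`y`-axis of length at least `2c` in each step (`IsPlay.step`, `IsPlay.conclusions`); the first jump,
from `(0, 1)` to `(c, b)`, is long enough because `3c² ≤ (1 - b)²`. The origin lies in all requests,
so the offline cost is at most `1`.

For `α = 1/2` each centre, of either kind, is cut off by the very next trapezoid in the sequence
`R₀, L₀, R₁, L₁, …`. Hence the runs on that fixed sequence jump in every step (`oblivious_runs`), and
one instance defeats both algorithms.
-/

noncomputable section

namespace NestedChasing

/-! ### Affine maps and minimum-volume ellipsoids -/

section Affine

variable {d : ℕ} (A : EuclideanSpace ℝ (Fin d) ≃L[ℝ] EuclideanSpace ℝ (Fin d))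
  (w : EuclideanSpace ℝ (Fin d))

/-- The affine automorphism `p ↦ w + A p`. -/
def affineMap : EuclideanSpace ℝ (Fin d) ≃ EuclideanSpace ℝ (Fin d) where
  toFun p := w + A p
  invFun p := -A.symm w + A.symm p
  left_inv p := by simp
  right_inv p := by simp

@[simp] lemma affineMap_apply (p : EuclideanSpace ℝ (Fin d)) : affineMap A w p = w + A p := rfl

lemma affineMap_symm : (affineMap A w).symm = affineMap A.symm (-A.symm w) := by
  ext1 p; rfl

lemma volume_image_affineMap (X : Set (EuclideanSpace ℝ (Fin d))) :
    volume (affineMap A w '' X) =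
      ENNReal.ofReal |LinearMap.det (A : EuclideanSpace ℝ (Fin d) →ₗ[ℝ] _)| * volume X := by
  have h : affineMap A w '' X = (fun q => -w + q) ⁻¹' (A '' X) := by
    ext q
    simp only [mem_image, mem_preimage, affineMap_apply]
    exact exists_congr fun p => and_congr_right fun _ =>
      ⟨fun h => by simp [← h], fun h => by simp [h]⟩
  rw [h, measure_preimage_add, Measure.addHaar_image_continuousLinearEquiv]

variable {A w}

lemma IsEllipsoidAt.image {E : Set (EuclideanSpace ℝ (Fin d))} {z : EuclideanSpace ℝ (Fin d)}
    (h : IsEllipsoidAt E z) : IsEllipsoidAt (affineMap A w '' E) (affineMap A w z) := by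
  obtain ⟨B, rfl⟩ := h
  refine ⟨B.trans A, ?_⟩
  rw [image_image]
  simp [add_assoc]

lemma IsMinEllipsoidAt.image {S E : Set (EuclideanSpace ℝ (Fin d))}
    {z : EuclideanSpace ℝ (Fin d)} (h : IsMinEllipsoidAt S E z) :
    IsMinEllipsoidAt (affineMap A w '' S) (affineMap A w '' E) (affineMap A w z) := by
  refine ⟨h.1.image, image_mono h.2.1, fun E' z' hE' hS => ?_⟩
  have h1 : volume E ≤ volume ((affineMap A w).symm '' E') := by
    refine h.2.2 _ ((affineMap A w).symm z') ?_ ?_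
    · rw [affineMap_symm]; exact hE'.image
    · rw [(affineMap A w).symm.image_eq_preimage_symm]
      exact fun p hp => hS ⟨p, hp, rfl⟩
  calc volume (affineMap A w '' E) ≤ volume (affineMap A w '' ((affineMap A w).symm '' E')) := by
        rw [volume_image_affineMap, volume_image_affineMap]
        gcongr
    _ = volume E' := by rw [Equiv.image_symm_image]

variable (A w)

/-- Affine automorphisms carry a unique minimum-volume ellipsoid to a unique one. -/
lemma isMinEllipsoidAt_image_iff {S E₀ : Set (EuclideanSpace ℝ (Fin d))}
    {z₀ : EuclideanSpace ℝ (Fin d)}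
    (h : ∀ E z, IsMinEllipsoidAt S E z ↔ E = E₀ ∧ z = z₀)
    (E : Set (EuclideanSpace ℝ (Fin d))) (z : EuclideanSpace ℝ (Fin d)) :
    IsMinEllipsoidAt (affineMap A w '' S) E z ↔
      E = affineMap A w '' E₀ ∧ z = affineMap A w z₀ := by
  constructor
  · intro hE
    have h1 : IsMinEllipsoidAt S ((affineMap A w).symm '' E) ((affineMap A w).symm z) := by
      have := hE.image (A := A.symm) (w := -A.symm w)
      rwa [← affineMap_symm, Equiv.symm_image_image] at this
    obtain ⟨h2, h3⟩ := (h _ _).1 h1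
    rw [← h2, ← h3]
    simp only [Equiv.image_symm_image, Equiv.apply_symm_apply, and_self]
  · rintro ⟨rfl, rfl⟩
    exact ((h _ _).2 ⟨rfl, rfl⟩).image

end Affine

/-! ### Coordinates in the plane -/

@[simp] lemma pt_zero (x y : ℝ) : pt x y 0 = x := by simp [pt]

@[simp] lemma pt_one (x y : ℝ) : pt x y 1 = y := by simp [pt]

lemma plane_ext {p q : Plane} (h0 : p 0 = q 0) (h1 : p 1 = q 1) : p = q := by
  ext i; fin_cases i <;> assumption

lemma norm_sq_plane (p : Plane) : ‖p‖ ^ 2 = p 0 ^ 2 + p 1 ^ 2 := by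
  rw [EuclideanSpace.real_norm_sq_eq, Fin.sum_univ_two]

lemma norm_le_one_iff (p : Plane) : ‖p‖ ≤ 1 ↔ p 0 ^ 2 + p 1 ^ 2 ≤ 1 := by
  rw [← norm_sq_plane, sq_le_one_iff₀ (norm_nonneg p)]

lemma linear_apply (B : Plane ≃L[ℝ] Plane) (p : Plane) (i : Fin 2) :
    B p i = B (pt 1 0) i * p 0 + B (pt 0 1) i * p 1 := by
  have h : p = p 0 • pt 1 0 + p 1 • pt 0 1 := plane_ext (by simp) (by simp)
  conv_lhs => rw [h, map_add, map_smul, map_smul]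
  simp [mul_comm]

lemma det_plane (B : Plane ≃L[ℝ] Plane) :
    LinearMap.det (B : Plane →ₗ[ℝ] Plane) =
      B (pt 1 0) 0 * B (pt 0 1) 1 - B (pt 0 1) 0 * B (pt 1 0) 1 := by
  have e0 : EuclideanSpace.basisFun (Fin 2) ℝ 0 = pt 1 0 := plane_ext (by simp) (by simp)
  have e1 : EuclideanSpace.basisFun (Fin 2) ℝ 1 = pt 0 1 := plane_ext (by simp) (by simp)
  rw [← LinearMap.det_toMatrix (EuclideanSpace.basisFun (Fin 2) ℝ).toBasis, Matrix.det_fin_two]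
  simp only [LinearMap.toMatrix_apply, OrthonormalBasis.coe_toBasis, e0, e1]
  simp

lemma det_mul_det_symm (A : Plane ≃L[ℝ] Plane) :
    LinearMap.det (A : Plane →ₗ[ℝ] Plane) * LinearMap.det (A.symm : Plane →ₗ[ℝ] Plane) = 1 :=
  LinearEquiv.det_mul_det_symm A.toLinearEquiv

/-- The lower triangular automorphism `(x, y) ↦ (σ x, μ x + τ y)`. -/
def triangular (σ μ τ : ℝ) (hσ : σ ≠ 0) (hτ : τ ≠ 0) : Plane ≃L[ℝ] Plane :=
  LinearEquiv.toContinuousLinearEquiv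
    { toFun := fun p => pt (σ * p 0) (μ * p 0 + τ * p 1)
      invFun := fun p => pt (p 0 / σ) ((p 1 - μ * (p 0 / σ)) / τ)
      map_add' := fun p q => plane_ext (by simp; ring) (by simp; ring)
      map_smul' := fun r p => plane_ext (by simp; ring) (by simp; ring)
      left_inv := fun p => plane_ext (by simp; field_simp) (by simp; field_simp; ring)
      right_inv := fun p => plane_ext (by simp; field_simp) (by simp; field_simp; ring) }

@[simp] lemma triangular_apply (σ μ τ : ℝ) (hσ : σ ≠ 0) (hτ : τ ≠ 0) (p : Plane) :
    triangular σ μ τ hσ hτ p = pt (σ * p 0) (μ * p 0 + τ * p 1) := rfl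

/-! ### The minimum-volume ellipse of a trapezoid -/

lemma mem_ellipse_iff (A : Plane ≃L[ℝ] Plane) (z u : Plane) :
    u ∈ (fun u => z + A u) '' Metric.closedBall 0 1 ↔ ‖A.symm u - A.symm z‖ ≤ 1 := by
  rw [← map_sub]
  constructor
  · rintro ⟨q, hq, rfl⟩
    simpa using hq
  · intro h
    exact ⟨A.symm (u - z), by simpa using h, by simp⟩

/-- The trace inequality behind the optimality of the unit disc: the contact points
`(x₁, ±y₁)`, `(-x₂, ±y₂)` carry weights proportional to `x₂`, `x₁` for which they are centred and
isotropic, and averaging `‖B u - w‖² ≤ 1` over them bounds the trace of `BᵀB`. -/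
lemma trace_bound {x₁ y₁ x₂ y₂ p q r s g h : ℝ} (hx₁ : 0 < x₁) (hx₂ : 0 < x₂)
    (h₁ : x₁ ^ 2 + y₁ ^ 2 = 1) (h₂ : x₂ ^ 2 + y₂ ^ 2 = 1) (h₁₂ : x₁ * x₂ = 1 / 2)
    (ha : (p * x₁ + q * y₁ - g) ^ 2 + (r * x₁ + s * y₁ - h) ^ 2 ≤ 1)
    (hb : (p * x₁ + q * -y₁ - g) ^ 2 + (r * x₁ + s * -y₁ - h) ^ 2 ≤ 1)
    (hc : (p * -x₂ + q * y₂ - g) ^ 2 + (r * -x₂ + s * y₂ - h) ^ 2 ≤ 1)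
    (hd : (p * -x₂ + q * -y₂ - g) ^ 2 + (r * -x₂ + s * -y₂ - h) ^ 2 ≤ 1) :
    (p ^ 2 + q ^ 2 + r ^ 2 + s ^ 2) / 2 + g ^ 2 + h ^ 2 ≤ 1 := by
  have hy₁ : y₁ ^ 2 = 1 - x₁ ^ 2 := by linarith
  have hy₂ : y₂ ^ 2 = 1 - x₂ ^ 2 := by linarith
  have key : x₂ * (((p * x₁ + q * y₁ - g) ^ 2 + (r * x₁ + s * y₁ - h) ^ 2) +
      ((p * x₁ + q * -y₁ - g) ^ 2 + (r * x₁ + s * -y₁ - h) ^ 2)) +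
      x₁ * (((p * -x₂ + q * y₂ - g) ^ 2 + (r * -x₂ + s * y₂ - h) ^ 2) +
      ((p * -x₂ + q * -y₂ - g) ^ 2 + (r * -x₂ + s * -y₂ - h) ^ 2)) =
      2 * (x₁ + x₂) * ((p ^ 2 + q ^ 2 + r ^ 2 + s ^ 2) / 2 + g ^ 2 + h ^ 2) := by
    linear_combination 2 * (x₂ * (q ^ 2 + s ^ 2)) * hy₁ + 2 * (x₁ * (q ^ 2 + s ^ 2)) * hy₂ +
      2 * (x₁ + x₂) * (p ^ 2 + r ^ 2 - q ^ 2 - s ^ 2) * h₁₂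
  have hab := mul_le_mul_of_nonneg_left (add_le_add ha hb) hx₂.le
  have hcd := mul_le_mul_of_nonneg_left (add_le_add hc hd) hx₁.le
  refine le_of_mul_le_mul_left ?_ (show 0 < 2 * (x₁ + x₂) by positivity)
  linarith

/-- The inequality of arithmetic and geometric means for the eigenvalues of `BᵀB`. -/
lemma det_sq_le_of_trace_bound {p q r s g h : ℝ}
    (hb : (p ^ 2 + q ^ 2 + r ^ 2 + s ^ 2) / 2 + g ^ 2 + h ^ 2 ≤ 1) :
    (p * s - q * r) ^ 2 ≤ 1 := by
  rw [sq_le_one_iff_abs_le_one, abs_le]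
  constructor <;>
    nlinarith [sq_nonneg (p - s), sq_nonneg (p + s), sq_nonneg (q - r), sq_nonneg (q + r),
      sq_nonneg g, sq_nonneg h]

/-- The equality case of `det_sq_le_of_trace_bound`. -/
lemma isometry_of_trace_bound {p q r s g h : ℝ}
    (hb : (p ^ 2 + q ^ 2 + r ^ 2 + s ^ 2) / 2 + g ^ 2 + h ^ 2 ≤ 1)
    (hdet : 1 ≤ (p * s - q * r) ^ 2) :
    g = 0 ∧ h = 0 ∧ ∀ x y, (p * x + q * y) ^ 2 + (r * x + s * y) ^ 2 = x ^ 2 + y ^ 2 := by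
  rw [one_le_sq_iff_one_le_abs, le_abs] at hdet
  rcases hdet with hdet | hdet
  · have key : (p - s) ^ 2 + (q + r) ^ 2 + 2 * g ^ 2 + 2 * h ^ 2 ≤ 0 := by linarith
    have := sq_nonneg (p - s)
    have := sq_nonneg (q + r)
    have := sq_nonneg g
    have := sq_nonneg h
    have hg : g = 0 := pow_eq_zero_iff two_ne_zero |>.1 (by linarith)
    have hh : h = 0 := pow_eq_zero_iff two_ne_zero |>.1 (by linarith)
    have hs : p - s = 0 := pow_eq_zero_iff two_ne_zero |>.1 (by linarith)
    have hr : q + r = 0 := pow_eq_zero_iff two_ne_zero |>.1 (by linarith)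
    obtain rfl : p = s := by linarith
    obtain rfl : r = -q := by linarith
    subst hg hh
    have h1 : p ^ 2 + q ^ 2 = 1 := by linarith
    exact ⟨rfl, rfl, fun x y => by linear_combination (x ^ 2 + y ^ 2) * h1⟩
  · have key : (p + s) ^ 2 + (q - r) ^ 2 + 2 * g ^ 2 + 2 * h ^ 2 ≤ 0 := by linarith
    have := sq_nonneg (p + s)
    have := sq_nonneg (q - r)
    have := sq_nonneg g
    have := sq_nonneg h
    have hg : g = 0 := pow_eq_zero_iff two_ne_zero |>.1 (by linarith)
    have hh : h = 0 := pow_eq_zero_iff two_ne_zero |>.1 (by linarith)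
    have hs : p + s = 0 := pow_eq_zero_iff two_ne_zero |>.1 (by linarith)
    have hr : q - r = 0 := pow_eq_zero_iff two_ne_zero |>.1 (by linarith)
    obtain rfl : s = -p := by linarith
    obtain rfl : q = r := by linarith
    subst hg hh
    have h1 : p ^ 2 + q ^ 2 = 1 := by linarith
    exact ⟨rfl, rfl, fun x y => by linear_combination (x ^ 2 + y ^ 2) * h1⟩

/-- John's criterion for the unit disc. If four contact points admit weights making them centred
and isotropic, the unit disc is the only minimum-volume ellipse enclosing them. -/
lemma isMinEllipsoidAt_iff_unitDisc {S : Set Plane} {x₁ y₁ x₂ y₂ : ℝ}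
    (hx₁ : 0 < x₁) (hx₂ : 0 < x₂)
    (h₁ : x₁ ^ 2 + y₁ ^ 2 = 1) (h₂ : x₂ ^ 2 + y₂ ^ 2 = 1) (h₁₂ : x₁ * x₂ = 1 / 2)
    (hS : S ⊆ Metric.closedBall 0 1)
    (ha : pt x₁ y₁ ∈ S) (hb : pt x₁ (-y₁) ∈ S) (hc : pt (-x₂) y₂ ∈ S) (hd : pt (-x₂) (-y₂) ∈ S)
    (E : Set Plane) (z : Plane) :
    IsMinEllipsoidAt S E z ↔ E = Metric.closedBall 0 1 ∧ z = 0 := by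
  have vol : ∀ (A : Plane ≃L[ℝ] Plane) (z : Plane),
      volume ((fun u => z + A u) '' Metric.closedBall 0 1) =
        ENNReal.ofReal |LinearMap.det (A : Plane →ₗ[ℝ] Plane)| *
          volume (Metric.closedBall (0 : Plane) 1) := fun A z =>
    volume_image_affineMap A z _
  have disc : IsEllipsoidAt (Metric.closedBall (0 : Plane) 1) 0 :=
    ⟨ContinuousLinearEquiv.refl ℝ Plane, by simp⟩
  have vol_pos : volume (Metric.closedBall (0 : Plane) 1) ≠ 0 :=
    (Metric.measure_closedBall_pos volume _ one_pos).ne'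
  have vol_fin : volume (Metric.closedBall (0 : Plane) 1) ≠ ∞ :=
    (isCompact_closedBall _ _).measure_lt_top.ne
  have bound : ∀ (A : Plane ≃L[ℝ] Plane) (z : Plane),
      S ⊆ (fun u => z + A u) '' Metric.closedBall 0 1 →
      (A.symm (pt 1 0) 0 ^ 2 + A.symm (pt 0 1) 0 ^ 2 + A.symm (pt 1 0) 1 ^ 2 +
        A.symm (pt 0 1) 1 ^ 2) / 2 + A.symm z 0 ^ 2 + A.symm z 1 ^ 2 ≤ 1 := by
    intro A z hSE
    have hm : ∀ x y, pt x y ∈ S →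
        (A.symm (pt 1 0) 0 * x + A.symm (pt 0 1) 0 * y - A.symm z 0) ^ 2 +
        (A.symm (pt 1 0) 1 * x + A.symm (pt 0 1) 1 * y - A.symm z 1) ^ 2 ≤ 1 := by
      intro x y hxy
      have h := (mem_ellipse_iff A z _).1 (hSE hxy)
      rw [norm_le_one_iff] at h
      simpa [linear_apply A.symm (pt x y)] using h
    exact trace_bound hx₁ hx₂ h₁ h₂ h₁₂ (hm _ _ ha) (hm _ _ hb) (hm _ _ hc) (hm _ _ hd)
  constructor
  · rintro ⟨⟨A, rfl⟩, hSE, hmin⟩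
    have hb := bound A z hSE
    have hvol := hmin _ _ disc hS
    have hle : |LinearMap.det (A : Plane →ₗ[ℝ] Plane)| ≤ 1 := by
      have : ENNReal.ofReal |LinearMap.det (A : Plane →ₗ[ℝ] Plane)| *
          volume (Metric.closedBall (0 : Plane) 1) ≤
          1 * volume (Metric.closedBall (0 : Plane) 1) := by
        rw [one_mul, ← vol A z]
        exact hvol
      rw [ENNReal.mul_le_mul_iff_left vol_pos vol_fin] at this
      exact ENNReal.ofReal_le_one.1 this
    have hdet := det_plane A.symm
    have hmul := det_mul_det_symm A
    have hge : 1 ≤ LinearMap.det (A.symm : Plane →ₗ[ℝ] Plane) ^ 2 := by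
      have h1 := (sq_le_one_iff_abs_le_one _).2 hle
      have h2 : LinearMap.det (A : Plane →ₗ[ℝ] Plane) ^ 2 *
        LinearMap.det (A.symm : Plane →ₗ[ℝ] Plane) ^ 2 = 1 := by rw [← mul_pow, hmul, one_pow]
      nlinarith [sq_nonneg (LinearMap.det (A.symm : Plane →ₗ[ℝ] Plane))]
    rw [hdet] at hge
    have happ := linear_apply A.symm
    obtain ⟨hz₀, hz₁, hiso⟩ := isometry_of_trace_bound hb hge
    have hz : A.symm z = 0 := plane_ext hz₀ hz₁
    have hz' : z = 0 := by simpa using hz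
    refine ⟨?_, hz'⟩
    ext u
    rw [mem_ellipse_iff, hz, sub_zero, mem_closedBall_zero_iff, norm_le_one_iff, norm_le_one_iff,
      happ u 0, happ u 1]
    rw [hiso]
  · rintro ⟨rfl, rfl⟩
    refine ⟨disc, hS, ?_⟩
    rintro E' z' ⟨A, rfl⟩ hSE
    have hb := bound A z' hSE
    have hdet := det_plane A.symm
    have hmul := det_mul_det_symm A
    have hge : 1 ≤ |LinearMap.det (A : Plane →ₗ[ℝ] Plane)| := by
      rw [← one_le_sq_iff_one_le_abs]
      have h1 : LinearMap.det (A.symm : Plane →ₗ[ℝ] Plane) ^ 2 ≤ 1 :=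
        hdet ▸ det_sq_le_of_trace_bound hb
      have h2 : LinearMap.det (A : Plane →ₗ[ℝ] Plane) ^ 2 *
        LinearMap.det (A.symm : Plane →ₗ[ℝ] Plane) ^ 2 = 1 := by rw [← mul_pow, hmul, one_pow]
      nlinarith [sq_nonneg (LinearMap.det (A : Plane →ₗ[ℝ] Plane))]
    rw [vol]
    exact le_mul_of_one_le_left' (ENNReal.one_le_ofReal.2 hge)

/-- The parameter `c` of the ellipse: the condition says that the trapezoid, sheared to be symmetric
and normalised to be inscribed in the unit circle, satisfies John's criterion. -/
lemma exists_center_param {α : ℝ} (h0 : 0 < α) (h1 : α < 1) :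
    ∃ c : ℝ, 0 < c ∧ c < 1 / 3 ∧ (1 - α ^ 2) * ((1 - c) * (1 + 3 * c)) = 4 * c := by
  have hα : 0 < 1 - α ^ 2 := by nlinarith
  have hcont : ContinuousOn (fun c : ℝ => 4 * c - (1 - α ^ 2) * ((1 - c) * (1 + 3 * c)))
      (Icc 0 (1 / 3)) := by fun_prop
  obtain ⟨c, ⟨hc0, hc1⟩, hc⟩ := intermediate_value_Ioo (by norm_num) hcont
    (show (0 : ℝ) ∈ Ioo _ _ from ⟨by linarith, by nlinarith⟩)
  exact ⟨c, hc0, hc1, by simp only at hc; linarith⟩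

lemma mem_firstBody {α : ℝ} {p : Plane} : p ∈ firstBody α ↔
    0 ≤ p 1 ∧ -1 ≤ p 0 ∧ p 0 ≤ 1 ∧ 2 * p 1 ≤ (1 - α) * p 0 + (1 + α) := by
  simp [firstBody, body, halfH, and_assoc]

lemma firstBody_le_one {α : ℝ} (h1 : α < 1) {p : Plane} (hp : p ∈ firstBody α) : p 1 ≤ 1 := by
  obtain ⟨_, _, k3, k4⟩ := mem_firstBody.1 hp
  nlinarith

/-- The minimum-volume ellipse of `F₁` and its centre, which lies on the midline of the trapezoid. -/
lemma exists_minEllipse_firstBody {α c : ℝ} (h0 : 0 < α) (h1 : α < 1) (hc0 : 0 < c)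
    (hc1 : c < 1 / 3) (hc : (1 - α ^ 2) * ((1 - c) * (1 + 3 * c)) = 4 * c) :
    ∃ E₀ : Set Plane, ∀ E z, IsMinEllipsoidAt (firstBody α) E z ↔
      E = E₀ ∧ z = pt c (((1 - α) * c + 1 + α) / 4) := by
  -- `a` and `b` are the semi-axes of the ellipse after the shear that makes the trapezoid
  -- symmetric; `y₁` is the normalised ordinate of the vertex `(1, 1)`.
  obtain ⟨a, ha, ha2⟩ : ∃ a : ℝ, 0 < a ∧ a ^ 2 = 2 * (1 - c ^ 2) :=
    ⟨√(2 * (1 - c ^ 2)), Real.sqrt_pos.2 (by nlinarith), Real.sq_sqrt (by nlinarith)⟩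
  obtain ⟨y₁, hy, hy2⟩ : ∃ y : ℝ, 0 < y ∧ y ^ 2 = (1 + 3 * c) / (2 * (1 + c)) :=
    ⟨√((1 + 3 * c) / (2 * (1 + c))), Real.sqrt_pos.2 (by positivity),
      Real.sq_sqrt (by positivity)⟩
  set b : ℝ := 1 / (2 * y₁) with hb
  have hb0 : b ≠ 0 := by positivity
  have hby : b * y₁ = 1 / 2 := by rw [hb]; field_simp
  set A := triangular a ((1 - α) * a / 4) b ha.ne' hb0 with hA
  set z₀ : Plane := pt c (((1 - α) * c + 1 + α) / 4) with hz₀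
  set S : Set Plane := affineMap A z₀ ⁻¹' firstBody α with hSdef
  have hS : ∀ x y, pt x y ∈ S ↔ 0 ≤ ((1 - α) * (c + a * x) + 1 + α) / 4 + b * y ∧
      -1 ≤ c + a * x ∧ c + a * x ≤ 1 ∧ b * y ≤ ((1 - α) * (c + a * x) + 1 + α) / 4 := by
    intro x y
    rw [hSdef, mem_preimage, mem_firstBody]
    simp only [affineMap_apply, hA, hz₀, triangular_apply, PiLp.add_apply, pt_zero, pt_one]
    constructor <;> rintro ⟨k1, k2, k3, k4⟩ <;> refine ⟨?_, ?_, ?_, ?_⟩ <;> linarith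
  have hx₁ : c + a * ((1 - c) / a) = 1 := by field_simp; ring
  have hx₂ : c + a * (-((1 + c) / a)) = -1 := by field_simp; ring
  have hc1' : 0 < 1 - c := by linarith
  have hα2 : α ^ 2 = (1 - 3 * c) * (1 + c) / ((1 - c) * (1 + 3 * c)) := by
    rw [eq_div_iff (by positivity)]; linarith
  have hfac : 1 - c ^ 2 = (1 - c) * (1 + c) := by ring
  have e₁ : ((1 - c) / a) ^ 2 + y₁ ^ 2 = 1 := by
    rw [div_pow, ha2, hy2, hfac]
    field_simp
    ring
  have e₂ : ((1 + c) / a) ^ 2 + (α * y₁) ^ 2 = 1 := by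
    rw [div_pow, mul_pow, ha2, hy2, hα2, hfac]
    field_simp
    ring
  have e₁₂ : (1 - c) / a * ((1 + c) / a) = 1 / 2 := by
    rw [div_mul_div_comm, ← sq, ha2, hfac]
    field_simp
  have main := isMinEllipsoidAt_iff_unitDisc (S := S) (x₁ := (1 - c) / a) (y₁ := y₁)
    (x₂ := (1 + c) / a) (y₂ := α * y₁) (by positivity) (by positivity) e₁ e₂ e₁₂ ?_
    (by rw [hS, hx₁, hby]; refine ⟨?_, ?_, ?_, ?_⟩ <;> linarith)
    (by rw [hS, hx₁, mul_neg, hby]; refine ⟨?_, ?_, ?_, ?_⟩ <;> linarith)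
    (by rw [hS, hx₂, mul_left_comm b, hby]; refine ⟨?_, ?_, ?_, ?_⟩ <;> linarith)
    (by rw [hS, hx₂, mul_neg b, mul_left_comm b, hby]; refine ⟨?_, ?_, ?_, ?_⟩ <;> linarith)
  · have himg : affineMap A z₀ '' S = firstBody α :=
      image_preimage_eq _ (affineMap A z₀).surjective
    have h := isMinEllipsoidAt_image_iff A z₀ main
    rw [himg, affineMap_apply, map_zero, add_zero] at h
    exact ⟨_, h⟩
  · intro p hp
    rw [show p = pt (p 0) (p 1) from plane_ext (by simp) (by simp), hS] at hp
    rw [mem_closedBall_zero_iff, norm_le_one_iff]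
    generalize p 0 = x at *
    generalize p 1 = y at *
    obtain ⟨ξ, hξ⟩ : ∃ ξ, ξ = c + a * x := ⟨_, rfl⟩
    rw [← hξ] at hp
    obtain ⟨k1, k2, k3, k4⟩ := hp
    have hx : x = (ξ - c) / a := by rw [hξ]; field_simp; ring
    have hy' : y ^ 2 = 4 * y₁ ^ 2 * (b * y) ^ 2 := by
      linear_combination (-2 * y₁ * b * y ^ 2 - y ^ 2) * 2 * hby
    have hby2 : (b * y) ^ 2 ≤ (((1 - α) * ξ + 1 + α) / 4) ^ 2 := sq_le_sq' (by linarith) k4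
    -- For fixed `ξ` the extreme ordinates lie on the slanted sides, where the defining quadratic
    -- function of the ellipse is convex in `ξ` and equals `1` at `ξ = ±1`.
    have hq : x ^ 2 + 4 * y₁ ^ 2 * (((1 - α) * ξ + 1 + α) / 4) ^ 2 =
        1 - ((1 / a) ^ 2 + y₁ ^ 2 * (1 - α) ^ 2 / 4) * (1 - ξ ^ 2) := by
      rw [hx]
      linear_combination (1 + ξ) / 2 * e₁ + (1 - ξ) / 2 * e₂
    have hk : 0 ≤ ((1 / a) ^ 2 + y₁ ^ 2 * (1 - α) ^ 2 / 4) * (1 - ξ ^ 2) :=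
      mul_nonneg (by positivity) (by nlinarith)
    have := mul_le_mul_of_nonneg_left hby2 (by positivity : 0 ≤ 4 * y₁ ^ 2)
    linarith

/-! ### Centroids -/

/-- Linear automorphisms carry centroids to centroids. -/
lemma isCentroid_image_iff {d : ℕ}
    (L : EuclideanSpace ℝ (Fin d) ≃L[ℝ] EuclideanSpace ℝ (Fin d))
    {S : Set (EuclideanSpace ℝ (Fin d))} (hS : MeasurableSet S)
    {z₀ : EuclideanSpace ℝ (Fin d)} (h : IsCentroid S z₀) (z : EuclideanSpace ℝ (Fin d)) :
    IsCentroid (L '' S) z ↔ z = L z₀ := by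
  have hdet : |(L : EuclideanSpace ℝ (Fin d) →L[ℝ] EuclideanSpace ℝ (Fin d)).det| ≠ 0 :=
    abs_ne_zero.2 (LinearEquiv.isUnit_det' L.toLinearEquiv).ne_zero
  have hint : ∫ x in L '' S, x =
      |(L : EuclideanSpace ℝ (Fin d) →L[ℝ] EuclideanSpace ℝ (Fin d)).det| • L (∫ x in S, x) := by
    rw [integral_image_eq_integral_abs_det_fderiv_smul volume hS
      (fun x _ => L.hasFDerivAt.hasFDerivWithinAt) L.injective.injOn, integral_smul,
      ContinuousLinearEquiv.integral_comp_comm]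
  have hvol : volume.real (L '' S) =
      |(L : EuclideanSpace ℝ (Fin d) →L[ℝ] EuclideanSpace ℝ (Fin d)).det| * volume.real S := by
    rw [measureReal_def, Measure.addHaar_image_continuousLinearEquiv, ENNReal.toReal_mul,
      ENNReal.toReal_ofReal (abs_nonneg _), measureReal_def]
    rfl
  unfold IsCentroid at h ⊢
  rw [h, setAverage_eq, setAverage_eq, hint, hvol, map_smul, smul_smul, mul_inv_rev,
    inv_mul_cancel_right₀ hdet]

lemma isCompact_firstBody {α : ℝ} (h1 : α < 1) : IsCompact (firstBody α) := by
  refine Metric.isCompact_of_isClosed_isBounded ?_ ?_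
  · refine ((IsClosed.inter (IsClosed.inter ?_ ?_) ?_).inter ?_)
    · exact isClosed_le (by fun_prop) (by fun_prop)
    · exact isClosed_le (by fun_prop) (by fun_prop)
    · exact isClosed_le (by fun_prop) (by fun_prop)
    · exact isClosed_le (by fun_prop) (by fun_prop)
  · refine Metric.isBounded_closedBall (x := (0 : Plane)) (r := 2) |>.subset fun p hp => ?_
    obtain ⟨k1, k2, k3, k4⟩ := mem_firstBody.1 hp
    rw [mem_closedBall_zero_iff]
    refine le_of_sq_le_sq ?_ (by norm_num)
    rw [norm_sq_plane]
    nlinarith [firstBody_le_one h1 hp]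

lemma setIntegral_firstBody {α : ℝ} (h0 : 0 < α) (h1 : α < 1) {g : Plane → ℝ}
    (hg : Continuous g) :
    ∫ p in firstBody α, g p =
      ∫ x in (-1 : ℝ)..1, ∫ y in (0 : ℝ)..(((1 - α) * x + (1 + α)) / 2), g (pt x y) := by
  set e : Plane ≃ᵐ ℝ × ℝ :=
    (MeasurableEquiv.toLp 2 (Fin 2 → ℝ)).symm.trans MeasurableEquiv.finTwoArrow with he
  have hmp : MeasurePreserving e :=
    (volume_preserving_finTwoArrow ℝ).comp
      (EuclideanSpace.volume_preserving_symm_measurableEquiv_toLp (Fin 2))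
  set T : Set (ℝ × ℝ) :=
    {q | 0 ≤ q.2 ∧ -1 ≤ q.1 ∧ q.1 ≤ 1 ∧ 2 * q.2 ≤ (1 - α) * q.1 + (1 + α)} with hT
  have hpre : firstBody α = e ⁻¹' T := by
    ext p
    rw [mem_firstBody]
    rfl
  have hTm : MeasurableSet T := by
    rw [← e.measurableSet_preimage, ← hpre]
    exact (isCompact_firstBody h1).measurableSet
  set f : ℝ × ℝ → ℝ := fun q => g (pt q.1 q.2)
  have hgf : ∀ p, g p = f (e p) := fun p => congrArg g (plane_ext (by rw [pt_zero]; rfl)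
    (by rw [pt_one]; rfl))
  have hint : IntegrableOn f T := by
    rw [← hmp.integrableOn_comp_preimage e.measurableEmbedding, ← hpre]
    refine IntegrableOn.congr_fun
      (hg.continuousOn.integrableOn_compact (isCompact_firstBody h1)) (fun p _ => hgf p)
      (isCompact_firstBody h1).measurableSet
  calc ∫ p in firstBody α, g p = ∫ p in e ⁻¹' T, f (e p) := by simp_rw [hgf, hpre]
    _ = ∫ q in T, f q := hmp.setIntegral_preimage_emb e.measurableEmbedding f T
    _ = ∫ q, T.indicator f q := (integral_indicator hTm).symm
    _ = ∫ x, ∫ y, T.indicator f (x, y) := by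
        rw [Measure.volume_eq_prod, integral_prod]
        rwa [← Measure.volume_eq_prod, integrable_indicator_iff hTm]
    _ = ∫ x, (Icc (-1 : ℝ) 1).indicator
        (fun x => ∫ y in (0 : ℝ)..(((1 - α) * x + (1 + α)) / 2), g (pt x y)) x := by
        congr 1
        ext x
        by_cases hx : x ∈ Icc (-1 : ℝ) 1
        · rw [indicator_of_mem hx, intervalIntegral.integral_of_le (by nlinarith [hx.1, hx.2]),
            ← integral_Icc_eq_integral_Ioc, ← integral_indicator measurableSet_Icc]
          congr 1
          ext y
          have : (x, y) ∈ T ↔ y ∈ Icc 0 (((1 - α) * x + (1 + α)) / 2) := by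
            simp only [hT, mem_ofPred_eq, mem_Icc]
            constructor
            · rintro ⟨k1, _, _, k4⟩
              exact ⟨k1, by linarith⟩
            · rintro ⟨k1, k4⟩
              exact ⟨k1, hx.1, hx.2, by linarith⟩
          by_cases hy : (x, y) ∈ T
          · rw [indicator_of_mem hy, indicator_of_mem (this.1 hy)]
          · rw [indicator_of_notMem hy, indicator_of_notMem (fun h => hy (this.2 h))]
        · rw [indicator_of_notMem hx]
          refine integral_eq_zero_of_ae (Eventually.of_forall fun y => ?_)
          exact indicator_of_notMem (fun h => hx ⟨h.2.1, h.2.2.1⟩) _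
    _ = _ := by
        rw [integral_indicator measurableSet_Icc, integral_Icc_eq_integral_Ioc,
          ← intervalIntegral.integral_of_le (by norm_num)]

lemma isCentroid_firstBody {α : ℝ} (h0 : 0 < α) (h1 : α < 1) :
    IsCentroid (firstBody α)
      (pt ((1 - α) / (3 * (1 + α))) ((1 + α + α ^ 2) / (3 * (1 + α)))) := by
  have hpos : 0 < 1 + α := by linarith
  have hvol : volume.real (firstBody α) = 1 + α := by
    have h := setIntegral_firstBody h0 h1 (g := fun _ => 1) continuous_const
    rw [setIntegral_const, smul_eq_mul, mul_one] at h
    rw [h]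
    simp only [intervalIntegral.integral_const, smul_eq_mul, mul_one, sub_zero]
    rw [intervalIntegral.integral_div, intervalIntegral.integral_add,
      intervalIntegral.integral_const_mul]
    · simp
      ring
    · exact (by fun_prop : Continuous fun x : ℝ => (1 - α) * x).intervalIntegrable _ _
    · simp
  have hx : ∫ p in firstBody α, p 0 = (1 - α) / 3 := by
    rw [setIntegral_firstBody h0 h1 (by fun_prop)]
    simp only [pt_zero, intervalIntegral.integral_const, smul_eq_mul, sub_zero]
    have : ∀ x : ℝ, ((1 - α) * x + (1 + α)) / 2 * x =
      (1 - α) / 2 * x ^ 2 + (1 + α) / 2 * x := fun x => by ring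
    simp_rw [this]
    rw [intervalIntegral.integral_add, intervalIntegral.integral_const_mul,
      intervalIntegral.integral_const_mul, integral_pow, integral_id]
    · norm_num
      ring
    · exact (by fun_prop : Continuous fun x : ℝ => (1 - α) / 2 * x ^ 2).intervalIntegrable _ _
    · exact (by fun_prop : Continuous fun x : ℝ => (1 + α) / 2 * x).intervalIntegrable _ _
  have hy : ∫ p in firstBody α, p 1 = (1 + α + α ^ 2) / 3 := by
    rw [setIntegral_firstBody h0 h1 (by fun_prop)]
    simp only [pt_one, integral_id]
    have : ∀ x : ℝ, ((((1 - α) * x + (1 + α)) / 2) ^ 2 - 0 ^ 2) / 2 =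
      (1 - α) ^ 2 / 8 * x ^ 2 + ((1 - α) * (1 + α) / 4 * x + (1 + α) ^ 2 / 8) := fun x => by ring
    simp_rw [this]
    rw [intervalIntegral.integral_add, intervalIntegral.integral_add,
      intervalIntegral.integral_const_mul,
      intervalIntegral.integral_const_mul, integral_pow, integral_id]
    · norm_num
      ring
    · exact (by fun_prop : Continuous fun x : ℝ =>
        (1 - α) * (1 + α) / 4 * x).intervalIntegrable _ _
    · simp
    · exact (by fun_prop : Continuous fun x : ℝ => (1 - α) ^ 2 / 8 * x ^ 2).intervalIntegrable _ _
    · exact (by fun_prop : Continuous fun x : ℝ =>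
        (1 - α) * (1 + α) / 4 * x + (1 + α) ^ 2 / 8).intervalIntegrable _ _
  have hcoord : ∀ i : Fin 2, (∫ p in firstBody α, p) i = ∫ p in firstBody α, p i := fun i =>
    ((EuclideanSpace.proj i : Plane →L[ℝ] ℝ).integral_comp_comm
      (continuousOn_id.integrableOn_compact (isCompact_firstBody h1))).symm
  unfold IsCentroid
  rw [setAverage_eq, hvol]
  refine plane_ext ?_ ?_
  · rw [pt_zero, PiLp.smul_apply, hcoord, hx, smul_eq_mul]
    field_simp
  · rw [pt_one, PiLp.smul_apply, hcoord, hy, smul_eq_mul]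
    field_simp

/-! ### The requests as linear images of the first one -/

/-- The halfspaces of the construction in one sequence `R₀, L₀, R₁, L₁, …`. -/
def halfspace (α : ℝ) (k : ℕ) : Set Plane :=
  {p | 2 * p 1 ≤ α ^ k * ((1 - α) * ((-1) ^ k * p 0) + (1 + α))}

/-- The possible requests `K(R₀), K(L₀), K(R₁), K(L₁), …` in one sequence. -/
def trapezoid (α : ℝ) (k : ℕ) : Set Plane := body (halfspace α k)

/-- The image `((-1)ᵏ c, b αᵏ)` of the centre `(c, b)` of `trapezoid α 0` in `trapezoid α k`. -/
def center (α c b : ℝ) (k : ℕ) : Plane := pt ((-1) ^ k * c) (b * α ^ k)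

lemma mem_halfspace {α : ℝ} {k : ℕ} {p : Plane} : p ∈ halfspace α k ↔
    2 * p 1 ≤ α ^ k * ((1 - α) * ((-1) ^ k * p 0) + (1 + α)) := Iff.rfl

lemma mem_trapezoid {α : ℝ} {k : ℕ} {p : Plane} : p ∈ trapezoid α k ↔
    0 ≤ p 1 ∧ -1 ≤ p 0 ∧ p 0 ≤ 1 ∧ p ∈ halfspace α k := by
  simp [trapezoid, body, and_assoc]

lemma halfspace_even (α : ℝ) (i : ℕ) : halfspace α (2 * i) = halfR α i := by
  ext p
  simp only [mem_halfspace, halfR, mem_ofPred_eq, (even_two_mul i).neg_one_pow]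
  rw [show α ^ (2 * i) * ((1 - α) * (1 * p 0) + (1 + α)) =
    (α ^ (2 * i) - α ^ (2 * i + 1)) * p 0 + (α ^ (2 * i) + α ^ (2 * i + 1)) by ring]

lemma halfspace_odd (α : ℝ) (i : ℕ) : halfspace α (2 * i + 1) = halfL α i := by
  ext p
  simp only [mem_halfspace, halfL, mem_ofPred_eq, (odd_two_mul_add_one i).neg_one_pow]
  rw [show α ^ (2 * i + 1) * ((1 - α) * (-1 * p 0) + (1 + α)) =
    (α ^ (2 * i + 2) - α ^ (2 * i + 1)) * p 0 + (α ^ (2 * i + 2) + α ^ (2 * i + 1)) by ring]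

lemma trapezoid_zero (α : ℝ) : trapezoid α 0 = firstBody α := by
  ext p
  simp [mem_trapezoid, mem_firstBody, mem_halfspace]

lemma neg_one_pow_mul_self (k : ℕ) (x : ℝ) : (-1) ^ k * ((-1) ^ k * x) = x := by
  rw [← mul_assoc, ← mul_pow]
  simp

lemma abs_neg_one_pow_mul (k : ℕ) (x : ℝ) : |(-1) ^ k * x| = |x| := by
  rw [abs_mul, abs_neg_one_pow, one_mul]

lemma neg_one_pow_mul_mem (k : ℕ) {x : ℝ} :
    (-1 ≤ (-1) ^ k * x ∧ (-1) ^ k * x ≤ 1) ↔ (-1 ≤ x ∧ x ≤ 1) := by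
  rw [← abs_le, ← abs_le, abs_neg_one_pow_mul]

/-- The diagonal map `(x, y) ↦ ρ • ((-1)ᵏ x, αᵏ y)`, which carries `F₁` to the `k`-th request,
scaled by `ρ`. -/
def requestMap {ρ α : ℝ} (hρ : 0 < ρ) (h0 : 0 < α) (k : ℕ) : Plane ≃L[ℝ] Plane :=
  triangular (ρ * (-1) ^ k) 0 (ρ * α ^ k) (by simp [hρ.ne']) (by positivity)

lemma requestMap_apply {ρ α : ℝ} (hρ : 0 < ρ) (h0 : 0 < α) (k : ℕ) (p : Plane) :
    requestMap hρ h0 k p = ρ • pt ((-1) ^ k * p 0) (p 1 * α ^ k) := by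
  refine plane_ext ?_ ?_
  · simp [requestMap, mul_assoc]
  · simp [requestMap, mul_assoc, mul_comm]

lemma image_requestMap {ρ α : ℝ} (hρ : 0 < ρ) (h0 : 0 < α) (k : ℕ) :
    requestMap hρ h0 k '' firstBody α = ρ • trapezoid α k := by
  have hα : 0 < α ^ k := by positivity
  have key : ∀ p, pt ((-1) ^ k * p 0) (p 1 * α ^ k) ∈ trapezoid α k ↔ p ∈ firstBody α := by
    intro p
    rw [mem_trapezoid, mem_firstBody, mem_halfspace]
    simp only [pt_zero, pt_one, neg_one_pow_mul_self]
    rw [mul_nonneg_iff_of_pos_right hα, ← and_assoc (a := -1 ≤ (-1) ^ k * p 0),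
      neg_one_pow_mul_mem, and_assoc,
      show 2 * (p 1 * α ^ k) = α ^ k * (2 * p 1) by ring, mul_le_mul_iff_right₀ hα]
  ext q
  constructor
  · rintro ⟨p, hp, rfl⟩
    rw [requestMap_apply]
    exact smul_mem_smul_set ((key p).2 hp)
  · rintro ⟨q, hq, rfl⟩
    have hq' : pt ((-1) ^ k * ((-1) ^ k * q 0)) (q 1 / α ^ k * α ^ k) = q :=
      plane_ext (by rw [pt_zero, neg_one_pow_mul_self])
        (by rw [pt_one, div_mul_cancel₀ _ hα.ne'])
    refine ⟨pt ((-1) ^ k * q 0) (q 1 / α ^ k), (key _).1 ?_, ?_⟩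
    · rw [pt_zero, pt_one, hq']
      exact hq
    · rw [requestMap_apply, pt_zero, pt_one, hq']

lemma requestMap_center {ρ α : ℝ} (hρ : 0 < ρ) (h0 : 0 < α) (k : ℕ) (c b : ℝ) :
    requestMap hρ h0 k (pt c b) = ρ • center α c b k := by
  rw [requestMap_apply, pt_zero, pt_one, center]

lemma isMinEllipsoidCenter_smul_trapezoid {ρ α : ℝ} (hρ : 0 < ρ) (h0 : 0 < α)
    {c b : ℝ} {E₀ : Set Plane}
    (h : ∀ E z, IsMinEllipsoidAt (firstBody α) E z ↔ E = E₀ ∧ z = pt c b) (k : ℕ) (z : Plane) :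
    IsMinEllipsoidCenter (ρ • trapezoid α k) z ↔ z = ρ • center α c b k := by
  have himg : affineMap (requestMap hρ h0 k) 0 '' firstBody α = ρ • trapezoid α k := by
    rw [← image_requestMap hρ h0 k]
    exact image_congr fun p _ => zero_add _
  have key := isMinEllipsoidAt_image_iff (requestMap hρ h0 k) 0 h
  rw [himg, affineMap_apply, zero_add, requestMap_center] at key
  simp [IsMinEllipsoidCenter, key]

lemma isCentroid_smul_trapezoid {ρ α : ℝ} (hρ : 0 < ρ) (h0 : 0 < α) (h1 : α < 1)
    {c b : ℝ} (h : IsCentroid (firstBody α) (pt c b)) (k : ℕ) (z : Plane) :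
    IsCentroid (ρ • trapezoid α k) z ↔ z = ρ • center α c b k := by
  rw [← image_requestMap hρ h0 k, ← requestMap_center hρ h0]
  exact isCentroid_image_iff _ (isCompact_firstBody h1).measurableSet h z

lemma convex_firstBody (α : ℝ) : Convex ℝ (firstBody α) := by
  intro p hp q hq a b ha hb hab
  obtain ⟨k1, k2, k3, k4⟩ := mem_firstBody.1 hp
  obtain ⟨m1, m2, m3, m4⟩ := mem_firstBody.1 hq
  obtain rfl : b = 1 - a := by linarith
  rw [mem_firstBody]
  simp only [PiLp.add_apply, PiLp.smul_apply, smul_eq_mul]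
  refine ⟨by positivity, ?_, ?_, ?_⟩
  · linarith [mul_le_mul_of_nonneg_left k2 ha, mul_le_mul_of_nonneg_left m2 hb]
  · linarith [mul_le_mul_of_nonneg_left k3 ha, mul_le_mul_of_nonneg_left m3 hb]
  · linarith [mul_le_mul_of_nonneg_left k4 ha, mul_le_mul_of_nonneg_left m4 hb]

lemma interior_firstBody_nonempty {α : ℝ} (h0 : 0 < α) : (interior (firstBody α)).Nonempty := by
  refine ⟨pt 0 (1 / 4), mem_interior.2
    ⟨{p | 0 < p 1} ∩ {p | -1 < p 0} ∩ {p | p 0 < 1} ∩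
      {p | 2 * p 1 < (1 - α) * p 0 + (1 + α)}, ?_, ?_, ?_⟩⟩
  · rintro p ⟨⟨⟨k1, k2⟩, k3⟩, k4⟩
    exact mem_firstBody.2 ⟨le_of_lt k1, le_of_lt k2, le_of_lt k3, le_of_lt k4⟩
  · refine ((IsOpen.inter ?_ ?_).inter ?_).inter ?_ <;>
      exact isOpen_lt (by fun_prop) (by fun_prop)
  · refine ⟨⟨⟨?_, ?_⟩, ?_⟩, ?_⟩ <;> simp only [mem_ofPred_eq, pt_zero, pt_one] <;> linarith

section Bodies

variable {α : ℝ}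

lemma trapezoid_antitone (h0 : 0 < α) (h1 : α < 1) : Antitone (trapezoid α) := by
  refine antitone_nat_of_succ_le fun k p hp => ?_
  obtain ⟨k1, k2, k3, k4⟩ := mem_trapezoid.1 hp
  refine mem_trapezoid.2 ⟨k1, k2, k3, ?_⟩
  rw [mem_halfspace] at k4 ⊢
  have hξ := (neg_one_pow_mul_mem k).2 ⟨k2, k3⟩
  have : 0 ≤ α ^ k * ((1 - α ^ 2) * (1 + (-1) ^ k * p 0)) :=
    mul_nonneg (by positivity) (mul_nonneg (by nlinarith) (by linarith [hξ.1]))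
  rw [pow_succ, pow_succ] at k4
  linarith

lemma trapezoid_subset_closedBall (h0 : 0 < α) (h1 : α < 1) (k : ℕ) :
    trapezoid α k ⊆ Metric.closedBall (pt 0 1) (√2) := by
  intro p hp
  have hp' := trapezoid_antitone h0 h1 (Nat.zero_le k) hp
  rw [trapezoid_zero] at hp'
  obtain ⟨k1, k2, k3, k4⟩ := mem_firstBody.1 hp'
  have hle := firstBody_le_one h1 hp'
  rw [Metric.mem_closedBall, dist_eq_norm]
  refine Real.le_sqrt_of_sq_le ?_
  rw [norm_sq_plane]
  simp only [PiLp.sub_apply, pt_zero, pt_one]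
  nlinarith

lemma zero_mem_trapezoid (h0 : 0 < α) (k : ℕ) : (0 : Plane) ∈ trapezoid α k := by
  simp only [mem_trapezoid, mem_halfspace, PiLp.zero_apply]
  refine ⟨le_rfl, by norm_num, by norm_num, ?_⟩
  have : 0 < α ^ k * (1 + α) := by positivity
  linarith

lemma start_notMem_trapezoid (h1 : α < 1) : pt 0 1 ∉ trapezoid α 0 := by
  rw [trapezoid_zero, mem_firstBody]
  simp only [pt_zero, pt_one]
  intro h
  linarith [h.2.2.2]

/-- Requests taken from the scaled trapezoids in increasing order form a nested instance. -/
lemma isNested_of_trapezoid {ρ : ℝ} (hρ : 0 < ρ) (h0 : 0 < α) (h1 : α < 1)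
    {F : ℕ → Set Plane}
    (hF : ∀ t, 1 ≤ t → ∃ k m, k ≤ m ∧ F t = ρ • trapezoid α k ∧ F (t + 1) = ρ • trapezoid α m) :
    IsNested F := by
  constructor
  · intro t ht
    obtain ⟨k, -, -, h, -⟩ := hF t ht
    rw [h, ← image_requestMap hρ h0]
    exact (convex_firstBody α).linear_image (requestMap hρ h0 k).toLinearMap
  · intro t ht
    obtain ⟨k, -, -, h, -⟩ := hF t ht
    rw [h, ← image_requestMap hρ h0]
    exact (isCompact_firstBody h1).image (requestMap hρ h0 k).continuous
  · intro t ht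
    obtain ⟨k, -, -, h, -⟩ := hF t ht
    rw [h, ← image_requestMap hρ h0]
    have := (requestMap hρ h0 k).toHomeomorph.image_interior (firstBody α)
    rw [ContinuousLinearEquiv.coe_toHomeomorph] at this
    rw [← this]
    exact (interior_firstBody_nonempty h0).image _
  · intro t ht
    obtain ⟨k, m, hkm, h, h'⟩ := hF t ht
    rw [h, h']
    exact smul_set_mono (trapezoid_antitone h0 h1 hkm)

lemma center_zero (α c b : ℝ) : center α c b 0 = pt c b := by simp [center]

lemma center_mem (h0 : 0 < α) {c b : ℝ} (h : pt c b ∈ firstBody α) (k : ℕ) :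
    center α c b k ∈ trapezoid α k := by
  have := mem_image_of_mem (requestMap one_pos h0 k) h
  rwa [image_requestMap, requestMap_center, one_smul, one_smul] at this

/-- If `L₀` cuts off the centre of `F₁`, then each trapezoid cuts off the previous centre. -/
lemma center_notMem_succ (h0 : 0 < α) {c b : ℝ}
    (h : α * ((1 + α) - (1 - α) * c) < 2 * b) (k : ℕ) :
    center α c b k ∉ trapezoid α (k + 1) := by
  intro hk
  have := (mem_trapezoid.1 hk).2.2.2
  have hs := neg_one_pow_mul_self k c
  simp only [mem_halfspace, center, pt_zero, pt_one, pow_succ, mul_neg, mul_one, neg_mul,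
    hs] at this
  have hk' : 0 < α ^ k := by positivity
  nlinarith

lemma two_mul_le_dist_center {c b : ℝ} {k m : ℕ} (h : ¬(Even k ↔ Even m)) :
    2 * c ≤ dist (center α c b k) (center α c b m) := by
  rw [dist_eq_norm]
  refine le_trans ?_ (PiLp.norm_apply_le _ 0)
  simp only [PiLp.sub_apply, center, pt_zero, Real.norm_eq_abs]
  rcases Nat.even_or_odd k with hk | hk <;> rcases Nat.even_or_odd m with hm | hm
  · simp [hk, hm] at h
  · rw [hk.neg_one_pow, hm.neg_one_pow]
    exact le_trans (by linarith) (le_abs_self _)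
  · rw [hk.neg_one_pow, hm.neg_one_pow]
    exact le_trans (by linarith) (neg_le_abs _)
  · simp [Nat.not_even_iff_odd.2 hk, Nat.not_even_iff_odd.2 hm] at h

lemma two_mul_le_dist_start {c b : ℝ} (h : 3 * c ^ 2 ≤ (1 - b) ^ 2) :
    2 * c ≤ dist (pt 0 1) (pt c b) := by
  rw [dist_eq_norm]
  refine le_of_sq_le_sq ?_ (norm_nonneg _)
  rw [norm_sq_plane]
  simp only [PiLp.sub_apply, pt_zero, pt_one]
  nlinarith

end Bodies

/-- Moving to the origin and staying there serves every request that contains the origin. -/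
lemma opt_le_edist_zero {d : ℕ} {v₀ : EuclideanSpace ℝ (Fin d)}
    {F : ℕ → Set (EuclideanSpace ℝ (Fin d))} (hF : ∀ t, 1 ≤ t → 0 ∈ F t) (N : ℕ) :
    opt v₀ F N ≤ edist v₀ 0 := by
  refine iInf₂_le_of_le (fun t => if t = 0 then v₀ else 0)
    ⟨by simp, fun t ht _ => by simpa [Nat.one_le_iff_ne_zero.1 ht] using hF t ht⟩ ?_
  calc _ ≤ ∑ t ∈ Finset.range N, if t = 0 then edist v₀ 0 else 0 :=
        Finset.sum_le_sum fun t _ => by by_cases ht : t = 0 <;> simp [ht]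
    _ ≤ _ := by
        rw [Finset.sum_ite_eq']
        split_ifs <;> simp

/-! ### Plays against the adversary -/

section Play

variable {rule : Set Plane → Plane → Prop} {α c b : ℝ}

lemma abs_le_one_of_mem (h : pt c b ∈ firstBody α) : |c| ≤ 1 := by
  obtain ⟨_, k2, k3, _⟩ := mem_firstBody.1 h
  exact abs_le.2 ⟨by simpa using k2, by simpa using k3⟩

/-- Among the halfspaces of the opposite parity there is a first one that cuts off the current
centre. -/
lemma exists_next (h0 : 0 < α) (h1 : α < 1) (hb : 0 < b) (hmem : pt c b ∈ firstBody α) (k : ℕ) :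
    ∃ m, (Even m ↔ ¬Even k) ∧ center α c b k ∉ halfspace α m ∧
      ∀ j, (Even j ↔ ¬Even k) → center α c b k ∉ halfspace α j → m ≤ j := by
  have hne : ∃ m, (Even m ↔ ¬Even k) ∧ center α c b k ∉ halfspace α m := by
    obtain ⟨n, hn⟩ := exists_pow_lt_of_lt_one (show 0 < b * α ^ k by positivity) h1
    obtain ⟨m, hnm, hm⟩ : ∃ m, n ≤ m ∧ (Even m ↔ ¬Even k) := by
      by_cases h : Even n ↔ ¬Even k
      · exact ⟨n, le_rfl, h⟩
      · exact ⟨n + 1, n.le_succ, by rw [Nat.even_add_one]; tauto⟩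
    refine ⟨m, hm, fun hmem' => ?_⟩
    rw [mem_halfspace] at hmem'
    simp only [center, pt_zero, pt_one] at hmem'
    have hc := abs_le_one_of_mem hmem
    rw [← abs_neg_one_pow_mul k, ← abs_neg_one_pow_mul m] at hc
    have hα : 0 < α ^ m := by positivity
    have hle : α ^ m ≤ α ^ n := pow_le_pow_of_le_one h0.le h1.le hnm
    have hc' := (abs_le.1 hc).2
    have h2 : (1 - α) * ((-1) ^ m * ((-1) ^ k * c)) + (1 + α) ≤ 2 := by nlinarith
    have h3 := mul_le_mul_of_nonneg_left h2 hα.le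
    linarith
  classical
  exact ⟨Nat.find hne, (Nat.find_spec hne).1, (Nat.find_spec hne).2,
    fun j hj hj' => Nat.find_min' hne ⟨hj, hj'⟩⟩

lemma isLeast_halfL {p : Plane} {i : ℕ} (h : p ∉ halfspace α (2 * i + 1))
    (hmin : ∀ j, Odd j → p ∉ halfspace α j → 2 * i + 1 ≤ j) :
    IsLeast {j | p ∉ halfL α j} i := by
  refine ⟨by rwa [mem_ofPred_eq, ← halfspace_odd], fun j hj => ?_⟩
  have := hmin (2 * j + 1) (odd_two_mul_add_one j) (by rwa [halfspace_odd])
  omega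

lemma isLeast_halfR {p : Plane} {i : ℕ} (h : p ∉ halfspace α (2 * i))
    (hmin : ∀ j, Even j → p ∉ halfspace α j → 2 * i ≤ j) :
    IsLeast {j | p ∉ halfR α j} i := by
  refine ⟨by rwa [mem_ofPred_eq, ← halfspace_even], fun j hj => ?_⟩
  have := hmin (2 * j) (even_two_mul j) (by rwa [halfspace_even])
  omega

lemma exists_play (h0 : 0 < α) (h1 : α < 1) (hb : 0 < b) (hmem : pt c b ∈ firstBody α)
    (hrule : ∀ k z, rule (trapezoid α k) z ↔ z = center α c b k) :
    ∃ v F, IsPlay rule α v F := by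
  choose next hpar hcut hmin using exists_next h0 h1 hb hmem
  set K : ℕ → ℕ := fun n => next^[n] 0 with hK
  have hKs : ∀ n, K (n + 1) = next (K n) := fun n => Function.iterate_succ_apply' _ _ _
  have hKe : ∀ n, Even (K n) ↔ Even n := by
    intro n
    induction n with
    | zero => simp [hK]
    | succ n ih => rw [hKs, hpar, ih, Nat.even_add_one]
  set v : ℕ → Plane := fun t => Nat.casesOn t (pt 0 1) fun n => center α c b (K n) with hv
  set F : ℕ → Set Plane := fun t => trapezoid α (K (t - 1)) with hF
  refine ⟨v, F, ⟨⟨rfl, ?_⟩, ?_, ?_, ?_⟩⟩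
  · rintro (_ | n)
    · exact ⟨fun h => absurd h (start_notMem_trapezoid h1), fun _ => (hrule _ _).2 rfl⟩
    · refine ⟨fun h => ?_, fun _ => (hrule _ _).2 rfl⟩
      have := (mem_trapezoid.1 h).2.2.2
      rw [Nat.add_sub_cancel, hKs] at this
      exact absurd this (hcut _)
  · exact trapezoid_zero α
  · intro t ht hte
    obtain ⟨n, rfl⟩ := Nat.exists_eq_add_of_le' ht
    have hn : Even (K n) := by rw [hKe]; simpa [Nat.even_add] using hte
    have hodd : Odd (K (n + 1)) := by
      rw [← Nat.not_even_iff_odd, hKs, hpar, not_not]; exact hn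
    obtain ⟨i, hi⟩ := hodd
    refine ⟨i, isLeast_halfL (p := v (n + 1)) ?_ ?_, ?_⟩
    · rw [← hi, hKs]
      exact hcut (K n)
    · intro j hj hj'
      rw [← hi, hKs]
      exact hmin _ _ (by rw [← Nat.not_odd_iff_even]; simp [hj, hn]) hj'
    · rw [← halfspace_odd, ← hi]
      rfl
  · intro t ht hto
    obtain ⟨n, rfl⟩ := Nat.exists_eq_add_of_le' ht
    have hn : ¬Even (K n) := by
      rw [hKe]; rw [← Nat.not_even_iff_odd] at hto; simpa [Nat.even_add] using hto
    have heven : Even (K (n + 1)) := by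
      rw [hKs, hpar]; exact hn
    obtain ⟨i, hi⟩ := heven.exists_two_nsmul
    rw [smul_eq_mul] at hi
    refine ⟨i, isLeast_halfR (p := v (n + 1)) ?_ ?_, ?_⟩
    · rw [← hi, hKs]
      exact hcut (K n)
    · intro j hj hj'
      rw [← hi, hKs]
      exact hmin _ _ (by simp [hj, hn]) hj'
    · rw [← halfspace_even, ← hi]
      rfl

/-- One round of the play: the new request cuts off the current centre, so it comes later in the
sequence of trapezoids, and the algorithm moves to its centre on the other side of the axis. -/
lemma IsPlay.step (h0 : 0 < α) (h1 : α < 1) (hmem : pt c b ∈ firstBody α)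
    (hrule : ∀ k z, rule (trapezoid α k) z ↔ z = center α c b k)
    {v : ℕ → Plane} {F : ℕ → Set Plane} (hplay : IsPlay rule α v F) {t k : ℕ} (ht : 1 ≤ t)
    (hv : v t = center α c b k) :
    ∃ m, k < m ∧ (Even m ↔ Odd (t + 1)) ∧ F (t + 1) = trapezoid α m ∧
      v (t + 1) = center α c b m := by
  obtain ⟨m, hpar, hcut, hF⟩ : ∃ m, (Even m ↔ Odd (t + 1)) ∧ v t ∉ halfspace α m ∧
      F (t + 1) = trapezoid α m := by
    rcases Nat.even_or_odd (t + 1) with he | ho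
    · obtain ⟨i, hi, hFi⟩ := hplay.even (t + 1) (by omega) he
      refine ⟨2 * i + 1, by simp [← Nat.not_even_iff_odd, he], ?_, ?_⟩
      · rw [halfspace_odd]; exact hi.1
      · rw [hFi, trapezoid, halfspace_odd]
    · obtain ⟨i, hi, hFi⟩ := hplay.odd (t + 1) (by omega) ho
      refine ⟨2 * i, by simp [ho], ?_, ?_⟩
      · rw [halfspace_even]; exact hi.1
      · rw [hFi, trapezoid, halfspace_even]
  refine ⟨m, ?_, hpar, hF, ?_⟩
  · by_contra! hle
    refine hcut ?_
    rw [hv]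
    exact (mem_trapezoid.1 (trapezoid_antitone h0 h1 hle (center_mem h0 hmem k))).2.2.2
  · rw [← hrule, ← hF]
    refine (hplay.run.2 t).2 fun h => hcut ?_
    rw [hF] at h
    exact (mem_trapezoid.1 h).2.2.2

lemma IsPlay.exists_center (h0 : 0 < α) (h1 : α < 1) (hmem : pt c b ∈ firstBody α)
    (hrule : ∀ k z, rule (trapezoid α k) z ↔ z = center α c b k)
    {v : ℕ → Plane} {F : ℕ → Set Plane} (hplay : IsPlay rule α v F) {t : ℕ} (ht : 1 ≤ t) :
    ∃ k, (Even k ↔ Odd t) ∧ F t = trapezoid α k ∧ v t = center α c b k := by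
  induction t, ht using Nat.le_induction with
  | base =>
    have hF : F 1 = trapezoid α 0 := hplay.first.trans (trapezoid_zero α).symm
    refine ⟨0, by simp, hF, ?_⟩
    rw [← hrule, ← hF]
    refine (hplay.run.2 0).2 ?_
    rw [hplay.run.1, hF]
    exact start_notMem_trapezoid h1
  | succ t ht ih =>
    obtain ⟨k, -, -, hv⟩ := ih
    obtain ⟨m, -, hm⟩ := hplay.step h0 h1 hmem hrule ht hv
    exact ⟨m, hm⟩

/-- The conclusions on plays that hold for every rule selecting centres compatible with the linear
maps between the requests. -/
lemma IsPlay.conclusions (h0 : 0 < α) (h1 : α < 1) (hmem : pt c b ∈ firstBody α)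
    (hstart : 3 * c ^ 2 ≤ (1 - b) ^ 2)
    (hrule : ∀ k z, rule (trapezoid α k) z ↔ z = center α c b k)
    {v : ℕ → Plane} {F : ℕ → Set Plane} (hplay : IsPlay rule α v F) :
    IsNested F ∧ IsBoundedInstance (Real.sqrt 2) (pt 0 1) F ∧
      (∀ t, 1 ≤ t → v t ∈ F t) ∧
      (∀ t, Odd t → ∃ i : ℕ, F t = body (halfR α i) ∧ v t = pt c (b * α ^ (2 * i))) ∧
      (∀ t, 1 ≤ t → Even t → ∃ i : ℕ, F t = body (halfL α i) ∧
        v t = pt (-c) (b * α ^ (2 * i + 1))) ∧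
      (∀ N : ℕ, N * (2 * c) ≤ cost v N) ∧
      (∀ N : ℕ, opt (pt 0 1) F N ≤ 1) := by
  have hcen := fun {t : ℕ} (ht : 1 ≤ t) => hplay.exists_center h0 h1 hmem hrule ht
  refine ⟨?_, ?_, ?_, ?_, ?_, ?_, ?_⟩
  · refine isNested_of_trapezoid one_pos h0 h1 fun t ht => ?_
    obtain ⟨k, -, hF, hv⟩ := hcen ht
    obtain ⟨m, hkm, -, hF', -⟩ := hplay.step h0 h1 hmem hrule ht hv
    exact ⟨k, m, hkm.le, by rw [hF, one_smul], by rw [hF', one_smul]⟩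
  · intro t ht
    obtain ⟨k, -, hF, -⟩ := hcen ht
    rw [hF]
    exact trapezoid_subset_closedBall h0 h1 k
  · intro t ht
    obtain ⟨k, -, hF, hv⟩ := hcen ht
    rw [hF, hv]
    exact center_mem h0 hmem k
  · intro t ht
    obtain ⟨k, hk, hF, hv⟩ := hcen ht.pos
    obtain ⟨i, rfl⟩ := even_iff_exists_two_mul.1 (hk.2 ht)
    refine ⟨i, by rw [hF, trapezoid, halfspace_even], ?_⟩
    rw [hv, center, (even_two_mul i).neg_one_pow, one_mul]
  · intro t ht hte
    obtain ⟨k, hk, hF, hv⟩ := hcen ht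
    have hodd : Odd k := by
      rw [← Nat.not_even_iff_odd, hk, Nat.not_odd_iff_even]; exact hte
    obtain ⟨i, rfl⟩ := hodd
    refine ⟨i, by rw [hF, trapezoid, halfspace_odd], ?_⟩
    rw [hv, center, (odd_two_mul_add_one i).neg_one_pow, neg_one_mul]
  · intro N
    rw [cost, ← nsmul_eq_mul]
    nth_rw 1 [← Finset.card_range N]
    refine Finset.card_nsmul_le_sum _ _ _ fun t _ => ?_
    rcases Nat.eq_zero_or_pos t with rfl | ht
    · obtain ⟨k, -, hF, hv⟩ := hcen (le_refl 1)
      have hv1 : v 1 = pt c b := by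
        rw [← center_zero α, ← hrule, trapezoid_zero, ← hplay.first]
        refine (hplay.run.2 0).2 ?_
        rw [hplay.run.1, hplay.first, ← trapezoid_zero]
        exact start_notMem_trapezoid h1
      rw [hplay.run.1, zero_add, hv1]
      exact two_mul_le_dist_start hstart
    · obtain ⟨k, hk, -, hv⟩ := hcen ht
      obtain ⟨m, -, hm, -, hv'⟩ := hplay.step h0 h1 hmem hrule ht hv
      rw [hv, hv']
      refine two_mul_le_dist_center ?_
      rw [hk, hm, Nat.odd_add_one]
      tauto
  · intro N
    refine (opt_le_edist_zero (fun t ht => ?_) N).trans ?_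
    · obtain ⟨k, -, hF, -⟩ := hcen ht
      rw [hF]
      exact zero_mem_trapezoid h0 k
    · rw [edist_dist, dist_zero_right]
      refine ENNReal.ofReal_le_one.2 ((norm_le_one_iff _).2 ?_)
      simp

end Play

/-! ### The oblivious instance -/

/-- The scaled trapezoids, requested one after the other. -/
def obliviousRequests (ρ α : ℝ) (t : ℕ) : Set Plane := ρ • trapezoid α (t - 1)

/-- When every trapezoid cuts off the previous centre, the run on the oblivious instance is forced
to jump in every step. -/
lemma oblivious_runs {rule : Set Plane → Plane → Prop} {ρ α c b : ℝ} (hρ : 0 < ρ) (h0 : 0 < α)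
    (h1 : α < 1) (hc : 0 < c) (hmem : pt c b ∈ firstBody α)
    (hcut : α * ((1 + α) - (1 - α) * c) < 2 * b)
    (hrule : ∀ k z, rule (ρ • trapezoid α k) z ↔ z = ρ • center α c b k) :
    (∃ v, IsRun rule (ρ • pt 0 1) (obliviousRequests ρ α) v) ∧
    ∀ v, IsRun rule (ρ • pt 0 1) (obliviousRequests ρ α) v →
      (∀ t, 1 ≤ t → v t ∈ obliviousRequests ρ α t) ∧ Tendsto (cost v) atTop atTop := by
  have hstart : ρ • pt 0 1 ∉ obliviousRequests ρ α 1 := fun h =>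
    start_notMem_trapezoid h1 ((smul_mem_smul_set_iff₀ hρ.ne' _ _).1 h)
  have hjump : ∀ n, ρ • center α c b n ∉ obliviousRequests ρ α (n + 1 + 1) := fun n h =>
    center_notMem_succ h0 hcut n ((smul_mem_smul_set_iff₀ hρ.ne' _ _).1 h)
  constructor
  · refine ⟨fun t => Nat.casesOn t (ρ • pt 0 1) fun n => ρ • center α c b n, rfl, ?_⟩
    rintro (_ | n)
    · exact ⟨fun h => absurd h hstart, fun _ => (hrule _ _).2 rfl⟩
    · exact ⟨fun h => absurd h (hjump n), fun _ => (hrule _ _).2 rfl⟩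
  · intro v hv
    have hcen : ∀ n, v (n + 1) = ρ • center α c b n := by
      intro n
      refine (hrule _ _).1 ((hv.2 n).2 ?_)
      induction n with
      | zero => rw [hv.1]; exact hstart
      | succ n ih => rw [(hrule _ _).1 ((hv.2 n).2 ih)]; exact hjump n
    constructor
    · intro t ht
      obtain ⟨n, rfl⟩ := Nat.exists_eq_add_of_le' ht
      rw [hcen]
      exact smul_mem_smul_set (center_mem h0 hmem n)
    · have hcost : ∀ N : ℕ, N * (ρ * (2 * c)) ≤ cost v (N + 1) := by
        intro N
        rw [cost, Finset.sum_range_succ', ← nsmul_eq_mul]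
        nth_rw 1 [← Finset.card_range N]
        refine le_add_of_le_of_nonneg (Finset.card_nsmul_le_sum _ _ _ fun n _ => ?_) dist_nonneg
        rw [hcen, hcen, dist_smul₀, Real.norm_of_nonneg hρ.le]
        refine mul_le_mul_of_nonneg_left (two_mul_le_dist_center ?_) hρ.le
        rw [Nat.even_add_one]
        tauto
      rw [← tendsto_add_atTop_iff_nat 1]
      exact tendsto_atTop_mono hcost
        (tendsto_natCast_atTop_atTop.atTop_mul_const (by positivity))

/-! ### The two centres of the first request -/

/-- The facts on the minimum-volume ellipse of `F₁` which the play depends on. -/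
lemma exists_minEllipse_center {α : ℝ} (h0 : 0 < α) (h1 : α < 1) :
    ∃ (c b : ℝ) (E₀ : Set Plane), 0 < c ∧ 0 < b ∧ pt c b ∈ firstBody α ∧
      3 * c ^ 2 ≤ (1 - b) ^ 2 ∧ 4 * b = (1 - α) * c + 1 + α ∧
      ∀ E z, IsMinEllipsoidAt (firstBody α) E z ↔ E = E₀ ∧ z = pt c b := by
  obtain ⟨c, hc0, hc1, hc⟩ := exists_center_param h0 h1
  obtain ⟨E₀, hE⟩ := exists_minEllipse_firstBody h0 h1 hc0 hc1 hc
  obtain ⟨b, hb⟩ : ∃ b, b = ((1 - α) * c + 1 + α) / 4 := ⟨_, rfl⟩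
  rw [← hb] at hE
  have hαc : 0 < (1 - α) * c := mul_pos (by linarith) hc0
  refine ⟨c, b, E₀, hc0, by linarith, ?_, ?_, by linarith, hE⟩
  · rw [mem_firstBody, pt_zero, pt_one]
    refine ⟨?_, ?_, ?_, ?_⟩ <;> linarith
  · have hαc' : (1 - α) * c ≤ (1 - α) * (1 / 3) :=
      mul_le_mul_of_nonneg_left hc1.le (by linarith)
    -- `c < 1 / 3` is enough for small `α`; for large `α` the defining equation gives `c ≤ 1 / 4`.
    rcases le_total α (1 / 2) with hα | hα
    · have : 7 / 12 ≤ 1 - b := by linarith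
      nlinarith
    · have hκ : 1 - α ^ 2 ≤ 3 / 4 := by nlinarith
      have hprod : 0 ≤ (1 - c) * (1 + 3 * c) := mul_nonneg (by linarith) (by linarith)
      have hle := mul_le_mul_of_nonneg_right hκ hprod
      have hc4 : c ≤ 1 / 4 := by nlinarith
      have : 1 / 2 ≤ 1 - b := by linarith
      nlinarith

/-- The facts on the centroid of `F₁` which the play depends on. -/
lemma exists_centroid_center {α : ℝ} (h0 : 0 < α) (h1 : α < 1) :
    ∃ c b : ℝ, 0 < c ∧ 0 < b ∧ pt c b ∈ firstBody α ∧ 3 * c ^ 2 ≤ (1 - b) ^ 2 ∧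
      IsCentroid (firstBody α) (pt c b) := by
  have hpos : 0 < 1 + α := by linarith
  have h1' : 0 < 1 - α := by linarith
  refine ⟨_, _, by positivity, by positivity, ?_, ?_, isCentroid_firstBody h0 h1⟩
  · rw [mem_firstBody, pt_zero, pt_one]
    have hc : (1 - α) / (3 * (1 + α)) ≤ 1 := by
      rw [div_le_one (by positivity)]; linarith
    refine ⟨by positivity, by linarith [show 0 ≤ (1 - α) / (3 * (1 + α)) by positivity], hc, ?_⟩
    have : (1 - α) * ((1 - α) / (3 * (1 + α))) + (1 + α) -
        2 * ((1 + α + α ^ 2) / (3 * (1 + α))) = 2 * (1 + α + α ^ 2) / (3 * (1 + α)) := by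
      field_simp; ring
    have : 0 ≤ 2 * (1 + α + α ^ 2) / (3 * (1 + α)) := by positivity
    linarith
  · have : 1 - (1 + α + α ^ 2) / (3 * (1 + α)) = (2 + 2 * α - α ^ 2) / (3 * (1 + α)) := by
      field_simp; ring
    rw [this, div_pow, div_pow, mul_div_assoc']
    refine div_le_div_of_nonneg_right ?_ (by positivity)
    nlinarith

end NestedChasing

end

theorem mainTheorem4 :
    -- (A) for some `α`, the minimum-volume ellipsoid of `F₁` has its centre in the open quadrant
    (∃ α : ℝ, 0 < α ∧ α < 1 ∧ (∃! E : Set Plane, ∃ z, IsMinEllipsoidAt (firstBody α) E z) ∧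
      ∃ c b : ℝ, 0 < c ∧ 0 < b ∧
        ∀ z, IsMinEllipsoidCenter (firstBody α) z ↔ z = pt c b) ∧
    -- (B) for every such `α`, the construction defeats the ellipsoid algorithm
    (∀ α c b : ℝ, 0 < α → α < 1 → 0 < c → 0 < b → IsMinEllipsoidCenter (firstBody α) (pt c b) →
      (∃ v F, IsPlay IsMinEllipsoidCenter α v F) ∧
      ∀ v F, IsPlay IsMinEllipsoidCenter α v F →
        IsNested F ∧ IsBoundedInstance (Real.sqrt 2) (pt 0 1) F ∧
        (∀ t, 1 ≤ t → v t ∈ F t) ∧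
        (∀ t, 1 ≤ t → ∀ z, IsMinEllipsoidCenter (F t) z ↔ z = v t) ∧
        (∀ t, Odd t → ∃ i : ℕ, F t = body (halfR α i) ∧ v t = pt c (b * α ^ (2 * i))) ∧
        (∀ t, 1 ≤ t → Even t → ∃ i : ℕ, F t = body (halfL α i) ∧
          v t = pt (-c) (b * α ^ (2 * i + 1))) ∧
        (∀ N : ℕ, N * (2 * c) ≤ cost v N) ∧
        (∀ N : ℕ, opt (pt 0 1) F N ≤ 1)) ∧
    -- (C) the construction defeats the centroid algorithm
    IsCentroid (firstBody (1 / 2)) (pt (1 / 9) (7 / 18)) ∧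
    (∀ α : ℝ, 0 < α → α < 1 →
      ∃ c b : ℝ, 0 < c ∧ 0 < b ∧ IsCentroid (firstBody α) (pt c b) ∧
      (∃ v F, IsPlay IsCentroid α v F) ∧
      ∀ v F, IsPlay IsCentroid α v F →
        IsNested F ∧ IsBoundedInstance (Real.sqrt 2) (pt 0 1) F ∧
        (∀ t, 1 ≤ t → v t ∈ F t) ∧
        (∀ t, Odd t → ∃ i : ℕ, F t = body (halfR α i) ∧ v t = pt c (b * α ^ (2 * i))) ∧
        (∀ t, 1 ≤ t → Even t → ∃ i : ℕ, F t = body (halfL α i) ∧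
          v t = pt (-c) (b * α ^ (2 * i + 1))) ∧
        (∀ N : ℕ, N * (2 * c) ≤ cost v N) ∧
        (∀ N : ℕ, opt (pt 0 1) F N ≤ 1)) ∧
    -- (D) one and the same 1-bounded instance, a scaled copy of the construction, defeats both
    (∃ (v₀ : Plane) (F : ℕ → Set Plane),
      IsNested F ∧ IsBoundedInstance 1 v₀ F ∧
      (∃ α ρ : ℝ, 0 < α ∧ α < 1 ∧ 0 < ρ ∧ v₀ = ρ • pt 0 1 ∧
        ∀ i : ℕ, F (2 * i + 1) = ρ • body (halfR α i) ∧ F (2 * i + 2) = ρ • body (halfL α i)) ∧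
      (∀ N : ℕ, opt v₀ F N ≤ 1) ∧
      (∃ v, IsRun IsMinEllipsoidCenter v₀ F v) ∧
      (∀ v, IsRun IsMinEllipsoidCenter v₀ F v →
        (∀ t, 1 ≤ t → v t ∈ F t) ∧ Tendsto (cost v) atTop atTop) ∧
      (∃ v, IsRun IsCentroid v₀ F v) ∧
      (∀ v, IsRun IsCentroid v₀ F v →
        (∀ t, 1 ≤ t → v t ∈ F t) ∧ Tendsto (cost v) atTop atTop)) := by
  refine ⟨?_, ?_, ?_, ?_, ?_⟩
  · obtain ⟨c, b, E₀, hc, hb, -, -, -, hE⟩ :=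
      exists_minEllipse_center (α := 1 / 2) (by norm_num) (by norm_num)
    refine ⟨1 / 2, by norm_num, by norm_num, ⟨E₀, ⟨_, (hE _ _).2 ⟨rfl, rfl⟩⟩, ?_⟩,
      c, b, hc, hb, fun z => by simp only [IsMinEllipsoidCenter, hE, exists_eq_left]⟩
    rintro E ⟨z, hz⟩
    exact ((hE _ _).1 hz).1
  · intro α c b h0 h1 _ hb hcen
    -- The given centre is the explicit one, by uniqueness of the minimum-volume ellipse.
    obtain ⟨c', b', E₀, -, -, hmem, hstart, -, hE⟩ := exists_minEllipse_center h0 h1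
    obtain ⟨E, hEc⟩ := hcen
    have heq := ((hE _ _).1 hEc).2
    obtain rfl : c = c' := by simpa using congrArg (fun p : Plane => p 0) heq
    obtain rfl : b = b' := by simpa using congrArg (fun p : Plane => p 1) heq
    have hrule : ∀ k z, IsMinEllipsoidCenter (trapezoid α k) z ↔ z = center α c b k := by
      intro k z
      simpa using isMinEllipsoidCenter_smul_trapezoid one_pos h0 hE k z
    refine ⟨exists_play h0 h1 hb hmem hrule, fun v F hplay => ?_⟩
    obtain ⟨r1, r2, r3, r4⟩ := hplay.conclusions h0 h1 hmem hstart hrule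
    refine ⟨r1, r2, r3, fun t ht z => ?_, r4⟩
    obtain ⟨k, -, hF, hv⟩ := hplay.exists_center h0 h1 hmem hrule ht
    rw [hF, hv, hrule]
  · have h := isCentroid_firstBody (α := 1 / 2) (by norm_num) (by norm_num)
    norm_num at h
    exact h
  · intro α h0 h1
    obtain ⟨c, b, hc, hb, hmem, hstart, hcen⟩ := exists_centroid_center h0 h1
    have hrule : ∀ k z, IsCentroid (trapezoid α k) z ↔ z = center α c b k := by
      intro k z
      simpa using isCentroid_smul_trapezoid one_pos h0 h1 hcen k z
    exact ⟨c, b, hc, hb, hcen, exists_play h0 h1 hb hmem hrule,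
      fun v F hplay => hplay.conclusions h0 h1 hmem hstart hrule⟩
  -- The scale `ρ = 1 / 2` serves because `√2 / 2 ≤ 1`; with `α = 1 / 2`, `L₀` cuts off both centres
  -- of `F₁`.
  · have h0 : (0 : ℝ) < 1 / 2 := by norm_num
    have h1 : (1 / 2 : ℝ) < 1 := by norm_num
    obtain ⟨c, b, E₀, hc, -, hmem, -, hbc, hE⟩ := exists_minEllipse_center h0 h1
    obtain ⟨c', b', hc', -, hmem', -, hcen⟩ := exists_centroid_center h0 h1
    have hellipse := oblivious_runs h0 h0 h1 hc hmem (by linarith)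
      (isMinEllipsoidCenter_smul_trapezoid h0 h0 hE)
    have hcentroid := oblivious_runs h0 h0 h1 hc' hmem' ?_
      (isCentroid_smul_trapezoid h0 h0 h1 hcen)
    · refine ⟨(1 / 2 : ℝ) • pt 0 1, obliviousRequests (1 / 2) (1 / 2), ?_, ?_,
        ⟨1 / 2, 1 / 2, h0, h1, h0, rfl, fun i => ⟨?_, ?_⟩⟩, fun N => ?_,
        hellipse.1, hellipse.2, hcentroid.1, hcentroid.2⟩
      · exact isNested_of_trapezoid h0 h0 h1 fun t _ => ⟨t - 1, t, by omega, rfl, rfl⟩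
      · intro t _
        refine (smul_set_mono (trapezoid_subset_closedBall h0 h1 (t - 1))).trans ?_
        rw [smul_closedBall _ _ (Real.sqrt_nonneg 2)]
        refine Metric.closedBall_subset_closedBall ?_
        have : √(2 : ℝ) ≤ 2 := Real.sqrt_le_iff.2 ⟨by norm_num, by norm_num⟩
        rw [Real.norm_of_nonneg h0.le]
        linarith
      · rw [obliviousRequests, trapezoid, Nat.add_sub_cancel, halfspace_even]
      · rw [obliviousRequests, trapezoid, show 2 * i + 2 - 1 = 2 * i + 1 from rfl, halfspace_odd]
      · refine (opt_le_edist_zero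
          (fun t _ => zero_mem_smul_set (zero_mem_trapezoid h0 _)) N).trans ?_
        rw [edist_dist, dist_zero_right]
        refine ENNReal.ofReal_le_one.2 ((norm_le_one_iff _).2 ?_)
        norm_num
    · have heq := hcen.trans (isCentroid_firstBody h0 h1).symm
      have hc9 : c' = 1 / 9 := by
        have := congrArg (fun p : Plane => p 0) heq
        norm_num at this
        linarith
      have hb18 : b' = 7 / 18 := by
        have := congrArg (fun p : Plane => p 1) heq
        norm_num at this
        linarith
      rw [hc9, hb18]
      norm_num
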